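/- Let $T$ be a locally finite rooted tree: a connected graph without cycles with finite vertex degrees and a root vertex $o$ that belongs to exactly one edge. For an edge $\alpha$ let $b(\alpha)$ be its endpoint closest to $o$, and write $\beta\ge\alpha$ if the geodesic from $o$ that ends with $\beta$ passes through $\alpha$. The boundary $\partial T$ is the set of half-infinite geodesics starting at $o$, together with the leaves (if any), a leaf being identified with the geodesic from $o$ that ends with it. For $x\in V(T)\cup\partial T$ let $P(x)$ be the set of edges of the geodesic from $o$ to $x$. Put $\partial T_\alpha=\{\zeta\in\partial T:\alpha\in P(\zeta)\}$, and give $\partial T$ the topology generated by the sets $\partial T_\alpha$. Fix $1<p<\infty$ and let $1/p+1/p'=1$. For $f:E(T)\to[0,\infty)$ let $If(x)=\sum_{\alpha\in P(x)}f(\alpha)$, $x\in V(T)\cup\partial T$ (so $If(o)=0$). For a finite positive Borel measure $\mu$ on $\partial T$ let $M(\alpha)=I^*\mu(\alpha)=\mu(\partial T_\alpha)$ be its co-potential. For an arbitrary $E\subseteq\partial T$ let $\Omega_E$ be the set of $f\in\ell^p(E(T))$ with $f\ge0$ and $If\ge1$ on $E$, and let $c_p(E)=\inf_{f\in\Omega_E}\|f\|_p^p$.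 The $p$-equilibrium function of $E$ is the (unique) $f$ in the $\ell^p$-closure of $\Omega_E$ with $\|f\|_p^p=c_p(E)$. The $p$-equilibrium measure of $E$ is the (unique) finite positive Borel measure $\mu$ supported in $\overline E$ such that $M^{p'-1}$ is the $p$-equilibrium function of $E$ and $\mu(\overline E)=c_p(E)=\|M^{p'-1}\|_p^p$. **Theorem.** Let $\mu$ be a finite positive Borel measure on $\partial T$ and $M=I^*\mu$. (i) If $\mu$ is the $p$-equilibrium measure of some set $E\subseteq\partial T$, then for every edge $\alpha$ $$M(\alpha)\Big(1-I(M^{p'-1})(b(\alpha))\Big)=\sum_{\beta\ge\alpha}M(\beta)^{p'},$$ where in particular the series converges. (ii) Conversely, if $\mu$ satisfies this equation for every edge $\alpha$ (the series being convergent), then there is an $F_\sigma$ set $E\subseteq\partial T$ such that $\mu$ is the $p$-equilibrium measure of $E$. -/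

import Mathlib

open MeasureTheory
open scoped ENNReal

/-- A locally finite rooted tree: a connected graph without cycles, with a distinguished root
vertex that is joined to exactly one other vertex (through the root edge). Leaves are allowed. -/
structure PlantedTree (V : Type*) where
  graph : SimpleGraph V
  isTree : graph.IsTree
  root : V
  root_edge : ∃! x, graph.Adj root x
  locallyFinite : ∀ x, (graph.neighborSet x).Finite

namespace PlantedTree

variable {V : Type*} (T : PlantedTree V)

/-- The edges of the tree, each one oriented away from the root. In a tree the two endpoints of
an edge lie at distances from the root that differ by one, so every edge occurs exactly once. -/
def Edge : Type _ :=
  {d : T.graph.Dart // T.graph.dist T.root d.snd = T.graph.dist T.root d.fst + 1}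

variable {T}

/-- The beginning `b(α)`: the endpoint of `α` which is closest to the root. -/
def Edge.b (α : T.Edge) : V := α.1.fst

/-- The end `e(α)`: the other endpoint of `α`. -/
def Edge.e (α : T.Edge) : V := α.1.snd

variable (T)

/-- The predecessor set `P(x)` of a vertex `x`: the edges of the geodesic from the root to `x`. -/
def pred (x : V) : Set T.Edge :=
  {α | ∃ w : T.graph.Walk T.root x, w.IsPath ∧ α.1.edge ∈ w.edges}

theorem pred_finite (x : V) : (T.pred x).Finite := by
  obtain ⟨w, -, hu⟩ := T.isTree.existsUnique_path T.root x
  have hinj : Function.Injective (fun α : T.Edge => α.1.edge) := by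
    rintro ⟨a, ha⟩ ⟨b, hb⟩ h
    have h' : a.edge = b.edge := h
    rcases SimpleGraph.dart_edge_eq_iff a b |>.1 h' with rfl | rfl
    · rfl
    · simp at ha hb
      omega
  refine Set.Finite.subset
    ((List.finite_toSet w.edges).preimage (f := fun α : T.Edge => α.1.edge) hinj.injOn) ?_
  rintro α ⟨w', hw', h⟩
  rw [hu w' hw'] at h
  exact h

/-- `α ≤ β` if the geodesic from the root that ends with `β` passes through `α`. -/
instance : LE T.Edge := ⟨fun α β => α ∈ T.pred β.e⟩

variable {T}

/-- A leaf is an edge with no edge strictly after it. -/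
def Edge.IsLeaf (α : T.Edge) : Prop := ∀ β : T.Edge, α ≤ β → β = α

variable (T)

/-- A set of edges is the edge set of a half-infinite geodesic starting from the root. -/
def IsRay (S : Set T.Edge) : Prop :=
  ∃ a : ℕ → T.Edge, (a 0).b = T.root ∧ (∀ n, (a (n + 1)).b = (a n).e) ∧ S = Set.range a

/-- A set of edges is the edge set of the geodesic from the root that ends with a leaf. -/
def IsLeafPath (S : Set T.Edge) : Prop :=
  ∃ α : T.Edge, α.IsLeaf ∧ S = T.pred α.e

/-- The boundary `∂T`: the half-infinite geodesics starting from the root, together with the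
leaves (if there are any). A boundary point is given by its set of edges. -/
def Boundary : Type _ := {S : Set T.Edge // T.IsRay S ∨ T.IsLeafPath S}

variable {T}

/-- The predecessor set `P(ζ)` of a boundary point. -/
def Boundary.pred (ζ : T.Boundary) : Set T.Edge := ζ.1

/-- The boundary `∂T_α` of the tent rooted in `α`, as a subset of `∂T`. -/
def tent (α : T.Edge) : Set T.Boundary := {ζ | α ∈ ζ.pred}

/-- The topology of `∂T` generated by the boundaries of the tents. -/
instance : TopologicalSpace T.Boundary :=
  TopologicalSpace.generateFrom (Set.range (tent (T := T)))

instance : MeasurableSpace T.Boundary := borel T.Boundary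

instance : BorelSpace T.Boundary := ⟨rfl⟩

/-- The co-potential `I*μ(α) = μ(∂T_α)`. -/
noncomputable def copotential (μ : Measure T.Boundary) (α : T.Edge) : ℝ := μ.real (tent α)

/-- The potential `If(x)` at a vertex, the sum of `f` over the finite set `P(x)`. -/
noncomputable def vertexPotential (f : T.Edge → ℝ) (x : V) : ℝ := ∑ᶠ α ∈ T.pred x, f α

/-- The potential `If(ζ) ∈ [0, ∞]` at a boundary point, for `f ≥ 0`. -/
noncomputable def boundaryPotential (f : T.Edge → ℝ) (ζ : T.Boundary) : ℝ≥0∞ :=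
  ∑' α : ζ.pred, ENNReal.ofReal (f α)

/-- The edge function `M_p = M ^ (p' - 1)`, where `M = I*μ` and `1 / p + 1 / p' = 1`. -/
noncomputable def edgeFunction (p : ℝ) (μ : Measure T.Boundary) (α : T.Edge) : ℝ :=
  copotential μ α ^ (p.conjExponent - 1)

instance factOneLeOfReal (p : ℝ) [hp : Fact (1 < p)] : Fact (1 ≤ ENNReal.ofReal p) :=
  ⟨ENNReal.one_le_ofReal.2 hp.out.le⟩

variable (T) in
/-- The space `ℓ^p(E(T))`. -/
abbrev EdgeLp (p : ℝ) := lp (fun _ : T.Edge => ℝ) (ENNReal.ofReal p)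

/-- The set `Ω_E` of all `f ≥ 0` in `ℓ^p` with `If ≥ 1` on `E`. -/
def testFunctions (p : ℝ) (E : Set T.Boundary) : Set (T.EdgeLp p) :=
  {f | (∀ α, 0 ≤ f α) ∧ ∀ ζ ∈ E, 1 ≤ boundaryPotential (fun α => f α) ζ}

/-- The `p`-capacity `c_p(E)`, the infimum of `‖f‖_p ^ p` over `f ∈ Ω_E`. -/
noncomputable def capacity (p : ℝ) (E : Set T.Boundary) : ℝ≥0∞ :=
  ⨅ f ∈ testFunctions p E, ENNReal.ofReal (‖f‖ ^ p)

/-- `f` is the `p`-equilibrium function of `E`: it belongs to the `ℓ^p`-closure of `Ω_E` and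
`‖f‖_p ^ p = c_p(E)`. -/
def IsEquilibriumFunction (p : ℝ) [Fact (1 < p)] (E : Set T.Boundary) (f : T.EdgeLp p) : Prop :=
  f ∈ closure (testFunctions p E) ∧ ENNReal.ofReal (‖f‖ ^ p) = capacity p E

/-- `μ` is the `p`-equilibrium measure of `E`: it is a finite Borel measure supported in the
closure of `E`, the edge function `M_p` is the `p`-equilibrium function of `E`, and the total mass
of `μ` is `c_p(E)` (which is also `‖M_p‖_p ^ p`). -/
structure IsEquilibriumMeasure (p : ℝ) [Fact (1 < p)] (E : Set T.Boundary)
    (μ : Measure T.Boundary) : Prop where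
  finite : IsFiniteMeasure μ
  support : μ (closure E)ᶜ = 0
  equilibriumFunction : ∃ f : T.EdgeLp p,
    (∀ α, f α = edgeFunction p μ α) ∧ IsEquilibriumFunction p E f
  mass : μ (closure E) = capacity p E

/-- The equation `M(α) (1 - I(M ^ (p' - 1))(b(α))) = ∑_{β ≥ α} M(β) ^ p'` for all edges `α`, where
`M = I*μ`; it includes the convergence of the series. -/
def SolvesEquilibriumEquation (p : ℝ) (μ : Measure T.Boundary) : Prop :=
  ∀ α : T.Edge, HasSum (fun β : {β : T.Edge // α ≤ β} => copotential μ β.1 ^ p.conjExponent)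
    (copotential μ α * (1 - vertexPotential (edgeFunction p μ) α.b))

end PlantedTree

/-! Write `f = M^(p'-1)`, so that `f * M = f^p = M^p'`. Both directions pass through the statement
that `If = 1` holds `μ`-a.e. By Tonelli, the integral of `If` over the tent of `α` is `If(b(α)) M(α)
+ ∑_{β ≥ α} M(β)^p'` (`setLIntegral_tent_edgeFunction`). Hence the equation at `α` says exactly that
`If` and `1` have the same integral over that tent.

(i) Minimality gives `If ≤ 1` a.e.: if the sum exceeded `1` along a geodesic ending in an edge with
`f > 0`, lowering `f` there would reduce the norm (`IsEquilibriumFunction.vertexPotential_le_one`).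
As `∫ If dμ = ‖f‖^p = c_p(E) = μ(∂T)`, equality holds a.e.

(ii) Tents form a π-system generating the Borel sets, so the equations force `If = 1` a.e. An `F_σ`
subset `E` of `{If = 1}` carries `μ`. Then `f ∈ Ω_E` gives `c_p(E) ≤ μ(∂T)`, and Hölder's inequality
gives the converse bound (`measure_univ_le_capacity`). -/

namespace PlantedTree

/-! ### Geodesics, the order on edges, and tents -/

section Combinatorics

variable {V : Type*} {T : PlantedTree V}

theorem dist_e (α : T.Edge) : T.graph.dist T.root α.e = T.graph.dist T.root α.b + 1 := α.2

theorem Edge.eq_of_edge_eq {α β : T.Edge} (h : α.1.edge = β.1.edge) : α = β := by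
  obtain ⟨a, ha⟩ := α
  obtain ⟨b, hb⟩ := β
  rcases SimpleGraph.dart_edge_eq_iff a b |>.1 h with rfl | rfl
  · rfl
  · simp at ha hb
    omega

theorem pred_root : T.pred T.root = ∅ := by
  ext α
  simp only [Set.mem_empty_iff_false, iff_false]
  rintro ⟨w, hw, h⟩
  rw [(SimpleGraph.Walk.isPath_iff_nil.1 hw).eq_nil] at h
  simp at h

/-- Appending `β` to a geodesic ending at `b(β)` gives a walk whose length is the distance, hence
the unique path. This recursion drives the inductions on vertices. -/
theorem pred_e (β : T.Edge) : T.pred β.e = insert β (T.pred β.b) := by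
  obtain ⟨w, hw, hl⟩ := T.isTree.connected.exists_path_of_dist T.root β.b
  have hadj : T.graph.Adj β.b β.e := β.1.adj
  have hpath : (w.concat hadj).IsPath := by
    refine SimpleGraph.Walk.isPath_of_length_eq_dist _ ?_
    rw [SimpleGraph.Walk.length_concat, hl, dist_e]
  have hunique : ∀ {x : V} {u v : T.graph.Walk T.root x}, u.IsPath → v.IsPath → u = v :=
    fun hu hv => (T.isTree.existsUnique_path T.root _).unique hu hv
  ext α
  constructor
  · rintro ⟨v, hv, h⟩
    rw [hunique hv hpath, SimpleGraph.Walk.edges_concat] at h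
    simp only [List.concat_eq_append, List.mem_append, List.mem_singleton] at h
    rcases h with h | h
    · exact Or.inr ⟨w, hw, h⟩
    · exact Or.inl (Edge.eq_of_edge_eq h)
  · rintro (rfl | ⟨v, hv, h⟩)
    · refine ⟨_, hpath, ?_⟩
      rw [SimpleGraph.Walk.edges_concat]
      simp only [List.concat_eq_append, List.mem_append, List.mem_singleton]
      exact Or.inr rfl
    · refine ⟨_, hpath, ?_⟩
      rw [SimpleGraph.Walk.edges_concat, ← hunique hv hw]
      simp [h]

theorem exists_edge_e_eq {x : V} (hx : x ≠ T.root) : ∃ β : T.Edge, β.e = x := by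
  obtain ⟨w, -, hl⟩ := T.isTree.connected.exists_path_of_dist T.root x
  have hnil : ¬ w.Nil := SimpleGraph.Walk.not_nil_of_ne hx.symm
  have hadj := w.adj_penultimate hnil
  refine ⟨⟨⟨(w.penultimate, x), hadj⟩, ?_⟩, rfl⟩
  have h1 : T.graph.dist T.root w.penultimate ≤ w.length - 1 := by
    refine (SimpleGraph.dist_le w.dropLast).trans ?_
    simp
  have h2 : T.graph.dist T.root x ≤ T.graph.dist T.root w.penultimate + 1 :=
    (T.isTree.connected.dist_triangle (v := w.penultimate)).trans
      (by rw [SimpleGraph.dist_eq_one_iff_adj.2 hadj])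
  have h3 : w.length ≠ 0 := by rwa [Ne, SimpleGraph.Walk.length_eq_zero_iff]
  show T.graph.dist T.root x = T.graph.dist T.root w.penultimate + 1
  omega

theorem vertex_induction {P : V → Prop} (h0 : P T.root) (h1 : ∀ β : T.Edge, P β.b → P β.e)
    (x : V) : P x := by
  induction hn : T.graph.dist T.root x generalizing x with
  | zero => rwa [← (T.isTree.connected.dist_eq_zero_iff).1 hn]
  | succ n ih =>
    obtain ⟨β, rfl⟩ := exists_edge_e_eq (T := T) (x := x) (by rintro rfl; simp at hn)
    exact h1 β (ih _ (by rw [dist_e] at hn; omega))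

theorem dist_e_le_of_mem_pred (x : V) :
    ∀ α ∈ T.pred x, T.graph.dist T.root α.e ≤ T.graph.dist T.root x := by
  induction x using vertex_induction (T := T) with
  | h0 => simp [pred_root]
  | h1 β ih =>
    rw [pred_e]
    rintro α (rfl | h)
    · exact le_rfl
    · rw [dist_e β]
      exact (ih α h).trans (Nat.le_succ _)

theorem le_def {α β : T.Edge} : α ≤ β ↔ α ∈ T.pred β.e := Iff.rfl

theorem Edge.le_refl (α : T.Edge) : α ≤ α := by
  rw [le_def, pred_e]
  exact Set.mem_insert _ _

theorem Edge.dist_le_of_le {α β : T.Edge} (h : α ≤ β) :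
    T.graph.dist T.root α.e ≤ T.graph.dist T.root β.e :=
  dist_e_le_of_mem_pred _ _ h

theorem le_iff_eq_or_mem_pred_b {α β : T.Edge} : β ≤ α ↔ β = α ∨ β ∈ T.pred α.b := by
  rw [le_def, pred_e]
  rfl

theorem pred_e_subset (x : V) : ∀ α ∈ T.pred x, T.pred α.e ⊆ T.pred x := by
  induction x using vertex_induction (T := T) with
  | h0 => simp [pred_root]
  | h1 β ih =>
    rintro α h
    rw [pred_e] at h
    rcases h with rfl | h
    · exact subset_rfl
    · rw [pred_e β]
      exact (ih α h).trans (Set.subset_insert _ _)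

theorem not_le_of_mem_pred_b {α β : T.Edge} (h : β ∈ T.pred α.b) : ¬ α ≤ β := by
  intro h'
  have h1 := dist_e_le_of_mem_pred _ _ h
  have h2 := Edge.dist_le_of_le h'
  rw [dist_e α] at h2
  omega

theorem le_total_of_mem_pred (x : V) : ∀ α ∈ T.pred x, ∀ β ∈ T.pred x, α ≤ β ∨ β ≤ α := by
  induction x using vertex_induction (T := T) with
  | h0 => simp [pred_root]
  | h1 γ ih =>
    intro α hα β hβ
    have hα' := hα
    have hβ' := hβ
    rw [pred_e] at hα hβ
    rcases hα with rfl | hα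
    · exact Or.inr hβ'
    · rcases hβ with rfl | hβ
      · exact Or.inl hα'
      · exact ih α hα β hβ

-- The root has a single neighbour, so every geodesic starts with the same edge. Its tent is the
-- whole boundary, and the equation there compares energy with total mass.
variable (T) in
theorem exists_rootEdge : ∃ ω : T.Edge, ω.b = T.root ∧ ∀ β : T.Edge, ω ≤ β := by
  obtain ⟨x, hx, hu⟩ := T.root_edge
  let ω : T.Edge := ⟨⟨(T.root, x), hx⟩, by
    show T.graph.dist T.root x = T.graph.dist T.root T.root + 1
    rw [SimpleGraph.dist_self, SimpleGraph.dist_eq_one_iff_adj.2 hx]⟩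
  have key : ∀ y, y = T.root ∨ ω ∈ T.pred y := by
    refine vertex_induction (T := T) (Or.inl rfl) (fun β ih => Or.inr ?_)
    rw [pred_e]
    rcases ih with ih | ih
    · left
      have hadj : T.graph.Adj β.b β.e := β.1.adj
      refine Subtype.ext (SimpleGraph.Dart.ext _ _ (Prod.ext ih.symm ?_))
      rw [ih] at hadj
      exact (hu _ hadj).symm
    · exact Or.inr ih
  refine ⟨ω, rfl, fun β => (key β.e).resolve_left fun h => ?_⟩
  have := dist_e β
  rw [h] at this
  simp at this

theorem ray_eq {a : ℕ → T.Edge} (h0 : (a 0).b = T.root) (h1 : ∀ n, (a (n + 1)).b = (a n).e)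
    (n : ℕ) : T.pred (a n).e = a '' Set.Iic n ∧ T.graph.dist T.root (a n).e = n + 1 := by
  induction n with
  | zero =>
    rw [pred_e, dist_e, h0, pred_root]
    refine ⟨?_, by simp⟩
    ext β
    simp [eq_comm]
  | succ n ih =>
    rw [pred_e, dist_e, h1, ih.1, ih.2, ← Set.image_insert_eq]
    refine ⟨congrArg _ ?_, rfl⟩
    ext k
    simp
    omega

theorem Boundary.pred_subset {ζ : T.Boundary} {α : T.Edge} (h : α ∈ ζ.pred) :
    T.pred α.e ⊆ ζ.pred := by
  rcases ζ.2 with ⟨a, h0, h1, hS⟩ | ⟨γ, -, hS⟩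
  · obtain ⟨n, rfl⟩ := hS.le h
    rw [(ray_eq h0 h1 n).1]
    exact (Set.image_subset_range _ _).trans hS.ge
  · exact (pred_e_subset _ _ (hS.le h)).trans hS.ge

theorem Boundary.le_total {ζ : T.Boundary} {α β : T.Edge} (hα : α ∈ ζ.pred) (hβ : β ∈ ζ.pred) :
    α ≤ β ∨ β ≤ α := by
  rcases ζ.2 with ⟨a, h0, h1, hS⟩ | ⟨γ, -, hS⟩
  · obtain ⟨m, rfl⟩ := hS.le hα
    obtain ⟨n, rfl⟩ := hS.le hβ
    rw [le_def, le_def, (ray_eq h0 h1 n).1, (ray_eq h0 h1 m).1]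
    rcases _root_.le_total m n with h | h
    · exact Or.inl ⟨m, h, rfl⟩
    · exact Or.inr ⟨n, h, rfl⟩
  · exact le_total_of_mem_pred γ.e _ (hS.le hα) _ (hS.le hβ)

theorem Boundary.nonempty_pred (ζ : T.Boundary) : ζ.pred.Nonempty := by
  obtain ⟨S, ⟨a, h0, h1, rfl⟩ | ⟨γ, -, rfl⟩⟩ := ζ
  · exact ⟨a 0, 0, rfl⟩
  · exact ⟨γ, γ.le_refl⟩

theorem tent_eq_univ {ω : T.Edge} (hω : ∀ β, ω ≤ β) : tent ω = Set.univ := by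
  refine Set.eq_univ_of_forall fun ζ => ?_
  obtain ⟨β, hβ⟩ := ζ.nonempty_pred
  exact Boundary.pred_subset hβ (hω β)

theorem tent_subset_tent {α β : T.Edge} (h : α ≤ β) : tent β ⊆ tent α :=
  fun _ hζ => Boundary.pred_subset hζ h

theorem tent_inter_tent_of_not_le {α β : T.Edge} (h1 : ¬ α ≤ β) (h2 : ¬ β ≤ α) :
    tent β ∩ tent α = ∅ := by
  refine Set.eq_empty_of_forall_notMem fun ζ hζ => ?_
  rcases Boundary.le_total hζ.1 hζ.2 with h | h
  · exact h2 h
  · exact h1 h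

theorem Boundary.exists_tent_disjoint {ζ : T.Boundary} {α : T.Edge} (h : α ∉ ζ.pred) :
    ∃ β ∈ ζ.pred, tent β ∩ tent α = ∅ := by
  obtain ⟨S, ⟨a, h0, h1, rfl⟩ | ⟨γ, hγ, rfl⟩⟩ := ζ
  -- The edge `a n` ends at distance `n + 1`, so with `n` the distance of `e(α)` it is too far out
  -- to lie below `α`.
  · refine ⟨a (T.graph.dist T.root α.e), ⟨_, rfl⟩, tent_inter_tent_of_not_le (fun h' => h ?_) ?_⟩
    · rw [le_def, (ray_eq h0 h1 _).1] at h'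
      exact Set.image_subset_range _ _ h'
    · intro h'
      have := Edge.dist_le_of_le h'
      rw [(ray_eq h0 h1 _).2] at this
      omega
  · refine ⟨γ, γ.le_refl, tent_inter_tent_of_not_le h fun h' => h ?_⟩
    rw [hγ α h']
    exact γ.le_refl

theorem Boundary.exists_subset_pred (ζ : T.Boundary) (s : Finset T.Edge) (hs : ↑s ⊆ ζ.pred) :
    ∃ α ∈ ζ.pred, (s : Set T.Edge) ⊆ T.pred α.e := by
  classical
  induction s using Finset.induction_on with
  | empty =>
    obtain ⟨α, hα⟩ := ζ.nonempty_pred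
    exact ⟨α, hα, by simp⟩
  | insert β s _ ih =>
    rw [Finset.coe_insert, Set.insert_subset_iff] at hs
    obtain ⟨α, hα, h⟩ := ih hs.2
    rcases Boundary.le_total hα hs.1 with h' | h'
    · refine ⟨β, hs.1, ?_⟩
      rw [Finset.coe_insert, Set.insert_subset_iff]
      exact ⟨β.le_refl, h.trans (pred_e_subset _ _ h')⟩
    · refine ⟨α, hα, ?_⟩
      rw [Finset.coe_insert, Set.insert_subset_iff]
      exact ⟨h', h⟩

/-- Spheres around the root are finite by local finiteness. Countability of the edges gives second
countability and handles unions of null tents. -/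
theorem countable_vertices (T : PlantedTree V) : Countable V := by
  have hfin : ∀ n : ℕ, {x | T.graph.dist T.root x = n}.Finite := by
    intro n
    induction n with
    | zero =>
      refine (Set.finite_singleton T.root).subset fun x hx => ?_
      exact ((T.isTree.connected.dist_eq_zero_iff).1 hx).symm
    | succ n ih =>
      refine (ih.biUnion fun x _ => T.locallyFinite x).subset fun x hx => ?_
      have hx' : T.graph.dist T.root x = n + 1 := hx
      obtain ⟨β, rfl⟩ := exists_edge_e_eq (T := T) (x := x) (by rintro rfl; simp at hx')
      rw [dist_e] at hx'
      exact Set.mem_biUnion (x := β.b) (by simpa using hx') β.1.adj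
  rw [← Set.countable_univ_iff]
  refine (Set.countable_iUnion fun n => (hfin n).countable).mono fun x _ => ?_
  exact Set.mem_iUnion.2 ⟨_, rfl⟩

instance : Countable T.Edge := by
  have := countable_vertices T
  refine Function.Injective.countable (f := fun α : T.Edge => (α.b, α.e)) fun α β h => ?_
  exact Subtype.ext (SimpleGraph.Dart.ext _ _ h)

end Combinatorics

/-! ### Clopen tents, regularity, and a generating π-system -/

section Topology

variable {V : Type*} {T : PlantedTree V}

theorem isOpen_tent (α : T.Edge) : IsOpen (tent α) :=
  TopologicalSpace.isOpen_generateFrom_of_mem ⟨α, rfl⟩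

theorem isClopen_tent (α : T.Edge) : IsClopen (tent α) := by
  refine ⟨⟨isOpen_iff_mem_nhds.2 fun ζ hζ => ?_⟩, isOpen_tent α⟩
  obtain ⟨β, hβ, h⟩ := Boundary.exists_tent_disjoint (T := T) hζ
  refine Filter.mem_of_superset ((isOpen_tent β).mem_nhds hβ) fun η hη hη' => ?_
  exact (h ▸ ⟨hη, hη'⟩ : η ∈ (∅ : Set T.Boundary))

theorem measurableSet_tent (α : T.Edge) : MeasurableSet (tent α) :=
  (isOpen_tent α).measurableSet

instance : SecondCountableTopology T.Boundary :=
  ⟨_, Set.countable_range _, rfl⟩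

/-- The indicators of the clopen tents induce the topology from a product of copies of `Bool`. With
second countability, this makes finite Borel measures weakly regular. -/
instance : RegularSpace T.Boundary := by
  have key : Topology.IsInducing (fun (ζ : T.Boundary) (α : T.Edge) =>
      (tent α).boolIndicator ζ) := by
    refine ⟨le_antisymm ?_ ?_⟩
    · rw [← continuous_iff_le_induced]
      exact continuous_pi fun α => (continuous_boolIndicator_iff_isClopen _).2 (isClopen_tent α)
    · refine le_generateFrom ?_
      rintro _ ⟨α, rfl⟩
      refine ⟨{g | g α = true}, ?_, ?_⟩
      · exact (isOpen_discrete ({true} : Set Bool)).preimage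
          (continuous_apply α : Continuous fun g : T.Edge → Bool => g α)
      · ext ζ
        exact (Set.mem_iff_boolIndicator _ _).symm
  exact key.regularSpace

theorem isPiSystem_tents : IsPiSystem (Set.range (tent (T := T))) := by
  rintro _ ⟨α, rfl⟩ _ ⟨β, rfl⟩ hne
  by_cases h1 : β ≤ α
  · exact ⟨α, (Set.inter_eq_left.2 (tent_subset_tent h1)).symm⟩
  by_cases h2 : α ≤ β
  · exact ⟨β, (Set.inter_eq_right.2 (tent_subset_tent h2)).symm⟩
  · rw [tent_inter_tent_of_not_le h1 h2] at hne
    exact absurd hne Set.not_nonempty_empty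

theorem borel_eq_generateFrom_tents :
    (inferInstance : MeasurableSpace T.Boundary) =
      MeasurableSpace.generateFrom (Set.range (tent (T := T))) :=
  borel_eq_generateFrom_of_subbasis rfl

end Topology

/-! ### Potentials and their integrals -/

section Potential

variable {V : Type*} {T : PlantedTree V}

theorem vertexPotential_eq_sum (f : T.Edge → ℝ) (x : V) :
    vertexPotential f x = ∑ α ∈ (T.pred_finite x).toFinset, f α :=
  finsum_mem_eq_finite_toFinset_sum _ _

theorem vertexPotential_nonneg {f : T.Edge → ℝ} (hf : ∀ α, 0 ≤ f α) (x : V) :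
    0 ≤ vertexPotential f x := by
  rw [vertexPotential_eq_sum]
  exact Finset.sum_nonneg fun α _ => hf α

theorem vertexPotential_root (f : T.Edge → ℝ) : vertexPotential f T.root = 0 := by
  simp [vertexPotential, pred_root]

theorem ofReal_vertexPotential {f : T.Edge → ℝ} (hf : ∀ α, 0 ≤ f α) (x : V) :
    ENNReal.ofReal (vertexPotential f x) =
      ∑' α, (T.pred x).indicator (fun β => ENNReal.ofReal (f β)) α := by
  rw [vertexPotential_eq_sum, ENNReal.ofReal_sum_of_nonneg fun α _ => hf α,
    tsum_eq_sum (s := (T.pred_finite x).toFinset)]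
  · refine Finset.sum_congr rfl fun α hα => ?_
    rw [Set.indicator_of_mem (by simpa using hα)]
  · intro α hα
    exact Set.indicator_of_notMem (by simpa using hα) _

theorem boundaryPotential_eq_tsum (f : T.Edge → ℝ) (ζ : T.Boundary) :
    boundaryPotential f ζ =
      ∑' α, (tent α).indicator (fun _ => ENNReal.ofReal (f α)) ζ := by
  rw [boundaryPotential, tsum_subtype ζ.pred (fun α => ENNReal.ofReal (f α))]
  rfl

theorem measurable_boundaryPotential (f : T.Edge → ℝ) :
    Measurable (boundaryPotential f) := by
  have : boundaryPotential f =
      fun ζ => ∑' α, (tent α).indicator (fun _ => ENNReal.ofReal (f α)) ζ :=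
    funext (boundaryPotential_eq_tsum f)
  rw [this]
  exact Measurable.tsum fun α => measurable_const.indicator (measurableSet_tent α)

theorem ofReal_vertexPotential_le {f : T.Edge → ℝ} (hf : ∀ α, 0 ≤ f α) {ζ : T.Boundary}
    {α : T.Edge} (h : α ∈ ζ.pred) :
    ENNReal.ofReal (vertexPotential f α.e) ≤ boundaryPotential f ζ := by
  rw [ofReal_vertexPotential hf, boundaryPotential,
    tsum_subtype ζ.pred (fun α => ENNReal.ofReal (f α))]
  refine ENNReal.tsum_le_tsum fun β => ?_
  exact Set.indicator_le_indicator_of_subset (Boundary.pred_subset h) (fun _ => zero_le) β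

/-- The edges of `ζ` form a chain, so each finite partial sum is dominated by the potential at the
end of one edge of `ζ`. -/
theorem boundaryPotential_le {f : T.Edge → ℝ} (hf : ∀ α, 0 ≤ f α) {ζ : T.Boundary} {c : ℝ}
    (h : ∀ α ∈ ζ.pred, vertexPotential f α.e ≤ c) :
    boundaryPotential f ζ ≤ ENNReal.ofReal c := by
  classical
  rw [boundaryPotential, ENNReal.tsum_eq_iSup_sum]
  refine iSup_le fun s => ?_
  obtain ⟨α, hα, hs⟩ := ζ.exists_subset_pred (s.map (Function.Embedding.subtype _)) (by
    intro β hβ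
    simp only [Finset.coe_map, Set.mem_image] at hβ
    obtain ⟨γ, -, rfl⟩ := hβ
    exact γ.2)
  refine le_trans ?_ (ENNReal.ofReal_le_ofReal (h α hα))
  rw [vertexPotential_eq_sum, ENNReal.ofReal_sum_of_nonneg fun α _ => hf α]
  calc ∑ β ∈ s, ENNReal.ofReal (f β)
      = ∑ β ∈ s.map (Function.Embedding.subtype _), ENNReal.ofReal (f β) := by
        rw [Finset.sum_map]; rfl
    _ ≤ _ := Finset.sum_le_sum_of_subset fun β hβ => by
        simpa using hs hβ

theorem setLIntegral_boundaryPotential (μ : Measure T.Boundary) (f : T.Edge → ℝ)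
    (s : Set T.Boundary) :
    ∫⁻ ζ in s, boundaryPotential f ζ ∂μ = ∑' β, ENNReal.ofReal (f β) * μ (tent β ∩ s) := by
  simp_rw [boundaryPotential_eq_tsum]
  rw [lintegral_tsum fun α => (measurable_const.indicator (measurableSet_tent α)).aemeasurable]
  refine tsum_congr fun β => ?_
  rw [lintegral_indicator_const (measurableSet_tent β),
    Measure.restrict_apply (measurableSet_tent β)]

theorem lintegral_boundaryPotential (μ : Measure T.Boundary) (f : T.Edge → ℝ) :
    ∫⁻ ζ, boundaryPotential f ζ ∂μ = ∑' β, ENNReal.ofReal (f β) * μ (tent β) := by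
  simpa using setLIntegral_boundaryPotential μ f Set.univ

/-- The integral of a potential over a tent splits at the beginning of the tent. -/
theorem setLIntegral_tent_boundaryPotential (μ : Measure T.Boundary) {f : T.Edge → ℝ}
    (hf : ∀ α, 0 ≤ f α) (α : T.Edge) :
    ∫⁻ ζ in tent α, boundaryPotential f ζ ∂μ =
      ENNReal.ofReal (vertexPotential f α.b) * μ (tent α) +
        ∑' β : {β : T.Edge // α ≤ β}, ENNReal.ofReal (f β) * μ (tent β.1) := by
  have hsub := tsum_subtype {β : T.Edge | α ≤ β} fun β => ENNReal.ofReal (f β) * μ (tent β)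
  rw [setLIntegral_boundaryPotential, ofReal_vertexPotential hf, ← ENNReal.tsum_mul_right]
  refine Eq.trans ?_ (congrArg _ hsub.symm)
  rw [← ENNReal.tsum_add]
  refine tsum_congr fun β => ?_
  -- The tent of `β` contains that of `α` if `β` precedes `α`, is contained in it if `β ≥ α`, and is
  -- disjoint from it otherwise.
  by_cases h1 : β ∈ T.pred α.b
  · have h2 : β ∉ {β : T.Edge | α ≤ β} := not_le_of_mem_pred_b h1
    rw [Set.indicator_of_mem h1, Set.indicator_of_notMem h2, add_zero,
      Set.inter_eq_right.2 (tent_subset_tent (le_iff_eq_or_mem_pred_b.2 (Or.inr h1)))]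
  · rw [Set.indicator_of_notMem h1, zero_mul, zero_add]
    by_cases h2 : β ∈ {β : T.Edge | α ≤ β}
    · rw [Set.indicator_of_mem h2, Set.inter_eq_left.2 (tent_subset_tent h2)]
    · rw [Set.indicator_of_notMem h2, tent_inter_tent_of_not_le h2, measure_empty, mul_zero]
      intro h3
      rcases le_iff_eq_or_mem_pred_b.1 h3 with rfl | h3
      · exact h2 β.le_refl
      · exact h1 h3

end Potential

/-! ### The edge function and perturbation of test functions -/

section EdgeFunction

variable {V : Type*} {T : PlantedTree V} {p : ℝ}

theorem copotential_nonneg (μ : Measure T.Boundary) (α : T.Edge) : 0 ≤ copotential μ α :=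
  measureReal_nonneg

theorem ofReal_copotential (μ : Measure T.Boundary) [IsFiniteMeasure μ] (α : T.Edge) :
    ENNReal.ofReal (copotential μ α) = μ (tent α) :=
  ofReal_measureReal

theorem edgeFunction_nonneg (μ : Measure T.Boundary) (α : T.Edge) : 0 ≤ edgeFunction p μ α :=
  Real.rpow_nonneg (copotential_nonneg μ α) _

theorem edgeFunction_rpow (hp : 1 < p) (μ : Measure T.Boundary) (α : T.Edge) :
    edgeFunction p μ α ^ p = copotential μ α ^ p.conjExponent := by
  rw [edgeFunction, ← Real.rpow_mul (copotential_nonneg μ α),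
    (Real.HolderConjugate.conjExponent hp).symm.sub_one_mul_conj]

theorem edgeFunction_mul_copotential (hp : 1 < p) (μ : Measure T.Boundary) (α : T.Edge) :
    edgeFunction p μ α * copotential μ α = copotential μ α ^ p.conjExponent := by
  have hq := (Real.HolderConjugate.conjExponent hp).symm.lt
  rcases (copotential_nonneg μ α).eq_or_lt with h | h
  · rw [← h, mul_zero, Real.zero_rpow (by linarith)]
  · rw [edgeFunction, Real.rpow_sub_one h.ne', div_mul_cancel₀ _ h.ne']

theorem ofReal_edgeFunction_mul (hp : 1 < p) (μ : Measure T.Boundary) [IsFiniteMeasure μ]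
    (α : T.Edge) :
    ENNReal.ofReal (edgeFunction p μ α) * μ (tent α) =
      ENNReal.ofReal (copotential μ α ^ p.conjExponent) := by
  rw [← edgeFunction_mul_copotential hp, ENNReal.ofReal_mul (edgeFunction_nonneg μ α),
    ofReal_copotential]

theorem toReal_ofReal_exponent [hp : Fact (1 < p)] : (ENNReal.ofReal p).toReal = p :=
  ENNReal.toReal_ofReal (zero_le_one.trans hp.out.le)

theorem hasSum_norm_rpow [hp : Fact (1 < p)] (f : T.EdgeLp p) :
    HasSum (fun α => ‖f α‖ ^ p) (‖f‖ ^ p) := by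
  have := lp.hasSum_norm (p := ENNReal.ofReal p)
    (by rw [toReal_ofReal_exponent]; linarith [hp.out]) f
  rwa [toReal_ofReal_exponent] at this

theorem capacity_le {E : Set T.Boundary} {g : T.EdgeLp p} (hg : g ∈ testFunctions p E) :
    capacity p E ≤ ENNReal.ofReal (‖g‖ ^ p) :=
  iInf₂_le g hg

open Classical in
theorem sub_single_apply (g : T.EdgeLp p) (α : T.Edge) (ε : ℝ) (β : T.Edge) :
    (g - lp.single (ENNReal.ofReal p) α ε : T.EdgeLp p) β =
      g β - Pi.single (M := fun _ => ℝ) α ε β := by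
  rw [← lp.single_apply]
  rfl

-- Geodesics through `α` have already accumulated `1 + ε` by the end of `α`, so they can afford the
-- loss; the others do not see it.
open Classical in
theorem sub_single_mem_testFunctions {E : Set T.Boundary} {g : T.EdgeLp p} (hg : g ∈ testFunctions p E)
    {α : T.Edge} {ε : ℝ} (h1 : ε ≤ g α) (h2 : 1 + ε ≤ vertexPotential (fun β => g β) α.e) :
    g - lp.single (ENNReal.ofReal p) α ε ∈ testFunctions p E := by
  have hnonneg : ∀ β, 0 ≤ (g - lp.single (ENNReal.ofReal p) α ε : T.EdgeLp p) β := by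
    intro β
    rw [sub_single_apply]
    rcases eq_or_ne β α with rfl | h
    · simpa using h1
    · simpa [h] using hg.1 β
  refine ⟨hnonneg, fun ζ hζ => ?_⟩
  by_cases h : α ∈ ζ.pred
  · refine le_trans ?_ (ofReal_vertexPotential_le hnonneg h)
    rw [ENNReal.one_le_ofReal]
    rw [vertexPotential_eq_sum] at h2 ⊢
    simp_rw [sub_single_apply, Finset.sum_sub_distrib]
    rw [Finset.sum_pi_single', if_pos]
    · linarith
    · exact (Set.Finite.mem_toFinset _).2 α.le_refl
  · refine (hg.2 ζ hζ).trans_eq (tsum_congr fun β => ?_)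
    have hne : β.1 ≠ α := fun h' => h (h' ▸ β.2)
    dsimp only
    rw [sub_single_apply, Pi.single_eq_of_ne hne, sub_zero]

end EdgeFunction

/-! ### Minimality of the equilibrium function -/

section Minimality

variable {V : Type*} {T : PlantedTree V} {p : ℝ} [hp : Fact (1 < p)] {E : Set T.Boundary}

theorem continuous_apply_edge (α : T.Edge) : Continuous fun g : T.EdgeLp p => g α :=
  (lp.evalCLM ℝ (fun _ : T.Edge => ℝ) (ENNReal.ofReal p) α).continuous

theorem continuous_vertexPotential (x : V) :
    Continuous fun g : T.EdgeLp p => vertexPotential (fun α => g α) x := by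
  simp_rw [vertexPotential_eq_sum]
  exact continuous_finsetSum _ fun α _ => continuous_apply_edge α

theorem IsEquilibriumFunction.norm_le {f g : T.EdgeLp p} (hf : IsEquilibriumFunction p E f)
    (hg : g ∈ testFunctions p E) : ‖f‖ ≤ ‖g‖ := by
  have h := capacity_le hg
  rw [← hf.2, ENNReal.ofReal_le_ofReal_iff (Real.rpow_nonneg (norm_nonneg _) _)] at h
  exact (Real.rpow_le_rpow_iff (norm_nonneg _) (norm_nonneg _)
    (zero_lt_one.trans hp.out)).1 h

theorem norm_lt_norm_of_apply {u v : T.EdgeLp p} (hle : ∀ β, ‖u β‖ ≤ ‖v β‖) {α : T.Edge}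
    (hlt : ‖u α‖ < ‖v α‖) : ‖u‖ < ‖v‖ := by
  have hp0 : 0 < p := zero_lt_one.trans hp.out
  refine (Real.rpow_lt_rpow_iff (norm_nonneg _) (norm_nonneg _) hp0).1 ?_
  exact hasSum_lt (fun β => Real.rpow_le_rpow (norm_nonneg _) (hle β) hp0.le)
    (Real.rpow_lt_rpow (norm_nonneg _) hlt hp0) (hasSum_norm_rpow u) (hasSum_norm_rpow v)

open Classical in
theorem norm_sub_single_lt {f : T.EdgeLp p} {α : T.Edge} {ε : ℝ} (h0 : 0 < ε) (h1 : ε ≤ f α) :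
    ‖f - lp.single (ENNReal.ofReal p) α ε‖ < ‖f‖ := by
  have hα : ‖(f - lp.single (ENNReal.ofReal p) α ε : T.EdgeLp p) α‖ < ‖f α‖ := by
    rw [sub_single_apply, Pi.single_eq_same, Real.norm_of_nonneg (by linarith),
      Real.norm_of_nonneg (by linarith)]
    linarith
  refine norm_lt_norm_of_apply (fun β => ?_) hα
  rcases eq_or_ne β α with rfl | h
  · exact hα.le
  · rw [sub_single_apply, Pi.single_eq_of_ne h, sub_zero]

theorem IsEquilibriumFunction.vertexPotential_le_one {f : T.EdgeLp p}
    (hf : IsEquilibriumFunction p E f) {α : T.Edge} (hα : 0 < f α) :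
    vertexPotential (fun β => f β) α.e ≤ 1 := by
  classical
  by_contra! hlt
  -- Since `f` lies only in the closure of `Ω_E`, the perturbation is applied to nearby test
  -- functions. Strict bounds on `ε` make it admissible for them as well.
  obtain ⟨ε, hε0, hε⟩ := exists_between
    (lt_min hα (sub_pos.2 hlt))
  have hε1 := hε.trans_le (min_le_left _ _)
  have hε2 := hε.trans_le (min_le_right _ _)
  have hfreq := (mem_closure_iff_frequently.1 hf.1).and_eventually
    (((continuous_apply_edge α).continuousAt.eventually_const_le hε1).and
      ((continuous_vertexPotential α.e).continuousAt.eventually_const_le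
        (u := 1 + ε) (by linarith)))
  have hclosed : IsClosed {g : T.EdgeLp p | ‖f‖ ≤ ‖g - lp.single (ENNReal.ofReal p) α ε‖} :=
    isClosed_le continuous_const (by fun_prop)
  have hmem := hclosed.mem_of_frequently_of_tendsto (b := nhds f) (f := id)
    (hfreq.mono fun g hg => hf.norm_le (sub_single_mem_testFunctions hg.1 hg.2.1 hg.2.2))
    Filter.tendsto_id
  exact absurd (norm_sub_single_lt hε0 hε1.le) (not_lt.2 hmem)

end Minimality

/-! ### The two implications -/

section Main

variable {V : Type*} {T : PlantedTree V} {p : ℝ} [hp : Fact (1 < p)]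

theorem setLIntegral_tent_edgeFunction (μ : Measure T.Boundary) [IsFiniteMeasure μ]
    (α : T.Edge) :
    ∫⁻ ζ in tent α, boundaryPotential (edgeFunction p μ) ζ ∂μ =
      ENNReal.ofReal (copotential μ α * vertexPotential (edgeFunction p μ) α.b) +
        ∑' β : {β : T.Edge // α ≤ β}, ENNReal.ofReal (copotential μ β.1 ^ p.conjExponent) := by
  rw [setLIntegral_tent_boundaryPotential μ (edgeFunction_nonneg μ),
    ENNReal.ofReal_mul (copotential_nonneg μ α), ofReal_copotential, mul_comm]
  simp_rw [ofReal_edgeFunction_mul hp.out]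

/-- The potential of the edge function of an equilibrium measure is almost everywhere one. -/
theorem IsEquilibriumMeasure.boundaryPotential_ae_eq {E : Set T.Boundary} {μ : Measure T.Boundary}
    (h : IsEquilibriumMeasure p E μ) : boundaryPotential (edgeFunction p μ) =ᵐ[μ] 1 := by
  have := h.finite
  obtain ⟨f, hfμ, hf⟩ := h.equilibriumFunction
  have hfμ' : (fun α => f α) = edgeFunction p μ := funext hfμ
  have hmass : capacity p E = μ Set.univ := by
    rw [← h.mass]
    exact measure_of_measure_compl_eq_zero h.support
  have hle : boundaryPotential (edgeFunction p μ) ≤ᵐ[μ] 1 := by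
    -- Almost every `ζ` avoids the countably many null tents, so `f > 0` on all of its edges and the
    -- minimality bound applies at each.
    have hnull : ∀ᵐ ζ ∂μ, ∀ α, μ (tent α) = 0 → ζ ∉ tent α := by
      refine ae_all_iff.2 fun α => ?_
      by_cases hα : μ (tent α) = 0
      · filter_upwards [measure_eq_zero_iff_ae_notMem.1 hα] with ζ hζ _ using hζ
      · exact Filter.Eventually.of_forall fun ζ h' => absurd h' hα
    filter_upwards [hnull] with ζ hζ
    refine (boundaryPotential_le (edgeFunction_nonneg μ) (c := 1) fun α hα => ?_).trans_eq
      ENNReal.ofReal_one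
    rw [← hfμ']
    refine hf.vertexPotential_le_one ?_
    rw [hfμ]
    refine Real.rpow_pos_of_pos ((copotential_nonneg μ α).lt_of_ne' fun h0 => ?_) _
    exact hζ α ((measureReal_eq_zero_iff).1 h0) hα
  have hint : ∫⁻ ζ, boundaryPotential (edgeFunction p μ) ζ ∂μ = μ Set.univ := by
    have hsum := hasSum_norm_rpow f
    have hterm : ∀ α, ‖f α‖ ^ p = copotential μ α ^ p.conjExponent := by
      intro α
      rw [hfμ, Real.norm_of_nonneg (edgeFunction_nonneg μ α), edgeFunction_rpow hp.out]
    simp_rw [hterm] at hsum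
    rw [lintegral_boundaryPotential]
    simp_rw [ofReal_edgeFunction_mul hp.out]
    rw [← ENNReal.ofReal_tsum_of_nonneg
      (fun α => Real.rpow_nonneg (copotential_nonneg μ α) _) hsum.summable, hsum.tsum_eq, hf.2,
      hmass]
  refine ae_eq_of_ae_le_of_lintegral_le hle ?_ aemeasurable_const ?_
  · rw [hint]
    exact measure_ne_top _ _
  · rw [hint]
    simp

theorem IsEquilibriumMeasure.solvesEquilibriumEquation {E : Set T.Boundary}
    {μ : Measure T.Boundary} (h : IsEquilibriumMeasure p E μ) :
    SolvesEquilibriumEquation p μ := by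
  have := h.finite
  intro α
  have hsplit := setLIntegral_tent_edgeFunction (p := p) μ α
  have hone : ∫⁻ ζ in tent α, boundaryPotential (edgeFunction p μ) ζ ∂μ = μ (tent α) := by
    rw [lintegral_congr_ae (ae_restrict_of_ae h.boundaryPotential_ae_eq)]
    simp
  rw [hone] at hsplit
  have hfin : ∑' β : {β : T.Edge // α ≤ β},
      ENNReal.ofReal (copotential μ β.1 ^ p.conjExponent) ≠ ∞ := by
    refine ne_top_of_le_ne_top (measure_ne_top μ (tent α)) ?_
    rw [hsplit]
    exact le_add_self
  have hnn : ∀ β : {β : T.Edge // α ≤ β}, 0 ≤ copotential μ β.1 ^ p.conjExponent :=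
    fun β => Real.rpow_nonneg (copotential_nonneg μ β.1) _
  have hsum : Summable fun β : {β : T.Edge // α ≤ β} => copotential μ β.1 ^ p.conjExponent := by
    refine (ENNReal.summable_toReal hfin).congr fun β => ?_
    exact ENNReal.toReal_ofReal (hnn β)
  convert hsum.hasSum using 1
  rw [← ENNReal.ofReal_tsum_of_nonneg hnn hsum, ← ofReal_copotential,
    ← ENNReal.ofReal_add (mul_nonneg (copotential_nonneg μ α)
      (vertexPotential_nonneg (edgeFunction_nonneg μ) _)) (tsum_nonneg hnn),
    ENNReal.ofReal_eq_ofReal_iff (copotential_nonneg μ α)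
      (add_nonneg (mul_nonneg (copotential_nonneg μ α)
      (vertexPotential_nonneg (edgeFunction_nonneg μ) _)) (tsum_nonneg hnn))] at hsplit
  linarith

theorem SolvesEquilibriumEquation.setLIntegral_tent {μ : Measure T.Boundary} [IsFiniteMeasure μ]
    (h : SolvesEquilibriumEquation p μ) (α : T.Edge) :
    ∫⁻ ζ in tent α, boundaryPotential (edgeFunction p μ) ζ ∂μ = μ (tent α) := by
  have hnn : ∀ β : {β : T.Edge // α ≤ β}, 0 ≤ copotential μ β.1 ^ p.conjExponent :=
    fun β => Real.rpow_nonneg (copotential_nonneg μ β.1) _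
  rw [setLIntegral_tent_edgeFunction, ← ENNReal.ofReal_tsum_of_nonneg hnn (h α).summable,
    ← ENNReal.ofReal_add (mul_nonneg (copotential_nonneg μ α)
      (vertexPotential_nonneg (edgeFunction_nonneg μ) _)) (tsum_nonneg hnn), (h α).tsum_eq,
    ← ofReal_copotential]
  congr 1
  ring

theorem SolvesEquilibriumEquation.boundaryPotential_ae_eq {μ : Measure T.Boundary}
    [IsFiniteMeasure μ] (h : SolvesEquilibriumEquation p μ) :
    boundaryPotential (edgeFunction p μ) =ᵐ[μ] 1 := by
  obtain ⟨ω, -, hω⟩ := exists_rootEdge T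
  have huniv : ∫⁻ ζ, boundaryPotential (edgeFunction p μ) ζ ∂μ = μ Set.univ := by
    have := h.setLIntegral_tent ω
    rwa [tent_eq_univ hω, Measure.restrict_univ] at this
  change boundaryPotential (edgeFunction p μ) =ᵐ[μ] fun _ => 1
  -- Equality a.e. becomes equality of `μ` with its multiple by the density `If`, which can be
  -- tested on tents.
  rw [← withDensity_eq_iff (measurable_boundaryPotential _).aemeasurable aemeasurable_const
    (by rw [huniv]; exact measure_ne_top _ _), withDensity_const, one_smul]
  refine (ext_of_generate_finite _ borel_eq_generateFrom_tents isPiSystem_tents ?_ ?_).symm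
  · rintro _ ⟨α, rfl⟩
    rw [withDensity_apply _ (measurableSet_tent α), h.setLIntegral_tent]
  · rw [withDensity_apply _ MeasurableSet.univ, setLIntegral_univ, huniv]

/-- Hölder's inequality bounds the energy of `μ` by the capacity of every set that carries `μ`. -/
theorem measure_univ_le_capacity {μ : Measure T.Boundary} [IsFiniteMeasure μ]
    {E : Set T.Boundary} (hE : μ Eᶜ = 0)
    (hM : HasSum (fun α => copotential μ α ^ p.conjExponent) (μ.real Set.univ)) :
    μ Set.univ ≤ capacity p E := by
  refine le_iInf₂ fun g hg => ?_
  have hconj := Real.HolderConjugate.conjExponent hp.out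
  have hg' : HasSum (fun α => g α ^ p) (‖g‖ ^ p) := by
    refine (hasSum_norm_rpow g).congr_fun fun α => ?_
    rw [Real.norm_of_nonneg (hg.1 α)]
  obtain ⟨hsum, hle⟩ := Real.summable_and_inner_le_Lp_mul_Lq_tsum_of_nonneg hconj hg.1
    (copotential_nonneg μ) hg'.summable hM.summable
  rw [hg'.tsum_eq, hM.tsum_eq, ← Real.rpow_mul (norm_nonneg g), mul_one_div_cancel hconj.ne_zero,
    Real.rpow_one] at hle
  have hm0 : 0 ≤ μ.real Set.univ := measureReal_nonneg
  have hlow : μ.real Set.univ ≤ ∑' α, g α * copotential μ α := by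
    rw [← ENNReal.ofReal_le_ofReal_iff
      (tsum_nonneg fun α => mul_nonneg (hg.1 α) (copotential_nonneg μ α)), ofReal_measureReal,
      ENNReal.ofReal_tsum_of_nonneg
        (fun α => mul_nonneg (hg.1 α) (copotential_nonneg μ α)) hsum]
    calc μ Set.univ = ∫⁻ _, 1 ∂μ := by simp
      _ ≤ ∫⁻ ζ, boundaryPotential (fun α => g α) ζ ∂μ := by
        refine lintegral_mono_ae ?_
        filter_upwards [measure_eq_zero_iff_ae_notMem.1 hE] with ζ hζ
        exact hg.2 ζ (not_not.1 hζ)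
      _ = _ := by
        rw [lintegral_boundaryPotential]
        refine tsum_congr fun α => ?_
        rw [ENNReal.ofReal_mul (hg.1 α), ofReal_copotential]
  rw [← ofReal_measureReal (μ := μ) (s := Set.univ)]
  refine ENNReal.ofReal_le_ofReal ?_
  rcases hm0.eq_or_lt with h0 | h0
  · rw [← h0]
    exact Real.rpow_nonneg (norm_nonneg g) _
  -- With `m = μ(∂T)`, Hölder gives `m ≤ ‖g‖ m^(1/p')`; divide by `m^(1/p')`.
  have hkey : μ.real Set.univ ^ (1 / p) ≤ ‖g‖ := by
    have h1 := hlow.trans hle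
    have h2 : μ.real Set.univ =
        μ.real Set.univ ^ (1 / p) * μ.real Set.univ ^ (1 / p.conjExponent) := by
      rw [← Real.rpow_add h0, one_div, one_div, hconj.inv_add_inv_eq_one, Real.rpow_one]
    nth_rewrite 1 [h2] at h1
    exact le_of_mul_le_mul_right h1 (Real.rpow_pos_of_pos h0 _)
  calc μ.real Set.univ = (μ.real Set.univ ^ (1 / p)) ^ p := by
        rw [← Real.rpow_mul hm0, one_div_mul_cancel hconj.ne_zero, Real.rpow_one]
    _ ≤ ‖g‖ ^ p := Real.rpow_le_rpow (Real.rpow_nonneg hm0 _) hkey hconj.nonneg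

theorem exists_iUnion_isClosed_subset {X : Type*} [TopologicalSpace X] [MeasurableSpace X]
    [OpensMeasurableSpace X] {μ : Measure X} [IsFiniteMeasure μ] [μ.WeaklyRegular] {A : Set X}
    (hA : MeasurableSet A) :
    ∃ K : ℕ → Set X, (∀ n, IsClosed (K n)) ∧ (⋃ n, K n) ⊆ A ∧ μ (A \ ⋃ n, K n) = 0 := by
  choose K hKA hK hμ using fun n : ℕ => hA.exists_isClosed_sdiff_lt (measure_ne_top μ A)
    (ε := ((n : ℝ≥0∞) + 1)⁻¹) (by simp)
  refine ⟨K, hK, Set.iUnion_subset hKA, le_antisymm ?_ zero_le⟩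
  refine ENNReal.le_of_forall_pos_le_add fun ε hε _ => ?_
  obtain ⟨n, hn⟩ := ENNReal.exists_inv_nat_lt (ENNReal.coe_pos.2 hε).ne'
  rw [zero_add]
  calc μ (A \ ⋃ n, K n) ≤ μ (A \ K n) :=
        measure_mono (Set.sdiff_subset_sdiff_right (Set.subset_iUnion K n))
    _ ≤ ((n : ℝ≥0∞) + 1)⁻¹ := (hμ n).le
    _ ≤ (n : ℝ≥0∞)⁻¹ := ENNReal.inv_le_inv.2 le_self_add
    _ ≤ ε := hn.le

theorem SolvesEquilibriumEquation.exists_isEquilibriumMeasure {μ : Measure T.Boundary}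
    [IsFiniteMeasure μ] (h : SolvesEquilibriumEquation p μ) :
    ∃ E : Set T.Boundary,
      (∃ K : ℕ → Set T.Boundary, (∀ n, IsClosed (K n)) ∧ E = ⋃ n, K n) ∧
        IsEquilibriumMeasure p E μ := by
  obtain ⟨K, hK, hsub, hdiff⟩ := exists_iUnion_isClosed_subset (μ := μ)
    (measurable_boundaryPotential (edgeFunction p μ) (measurableSet_singleton 1))
  refine ⟨⋃ n, K n, ⟨K, hK, rfl⟩, ?_⟩
  have hE : μ (⋃ n, K n)ᶜ = 0 := by
    refine measure_mono_null ?_ (measure_union_null hdiff h.boundaryPotential_ae_eq)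
    intro ζ hζ
    by_cases h1 : boundaryPotential (edgeFunction p μ) ζ = 1
    · exact Or.inl ⟨h1, hζ⟩
    · exact Or.inr h1
  have hsupp : μ (closure (⋃ n, K n))ᶜ = 0 :=
    measure_mono_null (Set.compl_subset_compl.2 subset_closure) hE
  -- At the root edge the potential term vanishes, so the equation reads energy equals total mass.
  have hM : HasSum (fun α => copotential μ α ^ p.conjExponent) (μ.real Set.univ) := by
    obtain ⟨ω, hroot, hω⟩ := exists_rootEdge T
    have hsum := h ω
    rw [hroot, vertexPotential_root, sub_zero, mul_one, copotential, tent_eq_univ hω] at hsum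
    exact (Equiv.subtypeUnivEquiv hω).hasSum_iff.1 hsum
  have hnorm : ∀ α, ‖edgeFunction p μ α‖ ^ p = copotential μ α ^ p.conjExponent := by
    intro α
    rw [Real.norm_of_nonneg (edgeFunction_nonneg μ α), edgeFunction_rpow hp.out]
  let f : T.EdgeLp p := ⟨edgeFunction p μ, memℓp_gen (by
    rw [toReal_ofReal_exponent]
    simp_rw [hnorm]
    exact hM.summable)⟩
  have hf : f ∈ testFunctions p (⋃ n, K n) :=
    ⟨edgeFunction_nonneg μ, fun ζ hζ => (hsub hζ : boundaryPotential (edgeFunction p μ) ζ = 1).ge⟩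
  have hfnorm : ENNReal.ofReal (‖f‖ ^ p) = μ Set.univ := by
    rw [(hasSum_norm_rpow f).unique (hM.congr_fun hnorm), ofReal_measureReal]
  have hcap : μ Set.univ = capacity p (⋃ n, K n) :=
    le_antisymm (measure_univ_le_capacity hE hM) (hfnorm ▸ capacity_le hf)
  exact
    { finite := inferInstance
      support := hsupp
      equilibriumFunction := ⟨f, fun _ => rfl, subset_closure hf, hfnorm.trans hcap⟩
      mass := (measure_of_measure_compl_eq_zero hsupp).trans hcap }

end Main

end PlantedTree

theorem mainTheorem1 {V : Type*} (T : PlantedTree V) (p : ℝ) [Fact (1 < p)]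
    (μ : MeasureTheory.Measure T.Boundary) [MeasureTheory.IsFiniteMeasure μ] :
    (∀ E : Set T.Boundary, PlantedTree.IsEquilibriumMeasure p E μ →
      PlantedTree.SolvesEquilibriumEquation p μ) ∧
    (PlantedTree.SolvesEquilibriumEquation p μ →
      ∃ E : Set T.Boundary,
        (∃ K : ℕ → Set T.Boundary, (∀ n, IsClosed (K n)) ∧ E = ⋃ n, K n) ∧
          PlantedTree.IsEquilibriumMeasure p E μ) :=
  ⟨fun _ h => h.solvesEquilibriumEquation, fun h => h.exists_isEquilibriumMeasure⟩
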